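/- Let $N\ge 1$ be an integer, $k$ a positive even integer and $m$ a positive integer. Let $f$ be a holomorphic cusp form of weight $k$ for $\Gamma_0(N)$, with Fourier expansion $f(z)=\sum_{n>0}a_f(n)e^{2\pi i n z}$, and suppose that $f|_kW_N=f$, where $W_N=\begin{pmatrix}0&-1/\sqrt N\\ \sqrt N&0\end{pmatrix}$ and $(f|_k\gamma)(z)=(cz+d)^{-k}f\!\left(\frac{az+b}{cz+d}\right)$ for $\gamma=\begin{pmatrix}a&b\\c&d\end{pmatrix}\in \mathrm{SL}_2(\mathbb R)$. Let $L_f(s)$ be the $L$-function of $f$, that is, the entire function with $L_f(s)=\sum_{n>0}a_f(n)n^{-s}$ for $\operatorname{Re}s$ large. Let $\zeta(s,z)$ be the Hurwitz zeta function, that is, for each $z$ the analytic continuation in $s$ to $\mathbb C\setminus\{1\}$ of $\sum_{n\ge 0}(z+n)^{-s}$ ($\operatorname{Re}s>1$), and write $\zeta^{(r)}(s,z)=\frac{\partial^r}{\partial s^r}\zeta(s,z)$; powers and logarithms are taken with the principal branch. Suppose that $L_f^{(j)}(k/2)=0$ for all $0\le j<m$. Then the integrals below exist and $$L_f^{(m)}\!\left(\frac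 k2\right)=\frac{i^k+i^{2m}}{\left(\frac k2-1\right)!}\,(-2\pi i)^{k/2}\sum_{j=0}^m\binom mj\log^j\!\left(\frac{i}{\sqrt N}\right)\int_{i/\sqrt N}^{i/\sqrt N+1}f(z)\,\zeta^{(m-j)}\!\left(1-\frac k2,z\right)dz,$$ where the integrals are along the horizontal segment from $i/\sqrt N$ to $i/\sqrt N+1$. -/

import Mathlib

open scoped MatrixGroups ModularForm Real Nat

/-- The space `S_k(N)` of holomorphic cusp forms of weight `k` for `Γ₀(N)`. -/
abbrev CuspFormGamma0 (N k : ℕ) : Type :=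
  CuspForm (CongruenceSubgroup.Gamma0 N : Subgroup (GL (Fin 2) ℝ)) (k : ℤ)

/-- The Fricke matrix `W_N = (0, -1/√N; √N, 0)` in `SL₂(ℝ)`. -/
noncomputable def frickeMatrix (N : ℕ) [NeZero N] : SL(2, ℝ) :=
  ⟨!![0, -1 / √(N : ℝ); √(N : ℝ), 0], by
    have h : √(N : ℝ) ≠ 0 :=
      (Real.sqrt_pos.mpr (Nat.cast_pos.mpr (Nat.pos_of_ne_zero (NeZero.ne N)))).ne'
    rw [Matrix.det_fin_two_of]
    field_simp
    ring⟩

/-- The condition `f|_k W_N = f`. -/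
def IsFrickeInvariant {N k : ℕ} [NeZero N] (f : CuspFormGamma0 N k) : Prop :=
  (f : UpperHalfPlane → ℂ) ∣[(k : ℤ)] (frickeMatrix N : GL (Fin 2) ℝ) = f

/-- The `L`-function `L_f` of a cusp form of positive weight for `Γ₀(N)`, as an entire function
(Mathlib's `L`-function of a modular form). -/
noncomputable def cuspFormL {N k : ℕ} [NeZero N] (hk : 0 < k) (f : CuspFormGamma0 N k) : ℂ → ℂ :=
  ModularForm.L (Int.natCast_pos.mpr hk) f

/-- `L_f` is entire. -/
theorem differentiable_cuspFormL {N k : ℕ} [NeZero N] (hk : 0 < k) (f : CuspFormGamma0 N k) :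
    Differentiable ℂ (cuspFormL hk f) :=
  CuspForm.differentiable_L (Int.natCast_pos.mpr hk) f

/-- `L_f` is the sum of the Dirichlet series of the Fourier coefficients of `f` at `∞`
in a right half-plane. -/
theorem hasSum_cuspFormL {N k : ℕ} [NeZero N] (hk : 0 < k) (f : CuspFormGamma0 N k)
    {s : ℂ} (hs : (k : ℝ) / 2 + 1 < s.re) :
    HasSum (fun n : ℕ ↦ (UpperHalfPlane.qExpansion 1 f).coeff n / (n : ℂ) ^ s)
      (cuspFormL hk f s) := by
  have h := CuspForm.hasSum_L (Int.natCast_pos.mpr hk) f (s := s) (by simpa using hs)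
  simpa [cuspFormL] using h

/-- `g` is an analytic continuation to `ℂ ∖ {1}` of the Hurwitz series `∑_{n ≥ 0} (z + n)^{-s}`,
`Re s > 1` (principal powers). -/
def IsHurwitzContinuation (z : ℂ) (g : ℂ → ℂ) : Prop :=
  DifferentiableOn ℂ g {1}ᶜ ∧
    ∀ s : ℂ, 1 < s.re → HasSum (fun n : ℕ ↦ (z + n) ^ (-s)) (g s)

/-- The analytic continuation of the Hurwitz series is unique on `ℂ ∖ {1}`. -/
theorem IsHurwitzContinuation.eqOn {z : ℂ} {g₁ g₂ : ℂ → ℂ}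
    (h₁ : IsHurwitzContinuation z g₁) (h₂ : IsHurwitzContinuation z g₂) :
    Set.EqOn g₁ g₂ {1}ᶜ := by
  have hU : IsPreconnected ({1}ᶜ : Set ℂ) :=
    (isConnected_compl_singleton_of_one_lt_rank (by simp) 1).isPreconnected
  refine (h₁.1.analyticOnNhd isOpen_compl_singleton).eqOn_of_preconnected_of_eventuallyEq
    (h₂.1.analyticOnNhd isOpen_compl_singleton) hU (z₀ := 2) (by simp) ?_
  have hV : {s : ℂ | 1 < s.re} ∈ nhds (2 : ℂ) :=
    (isOpen_lt continuous_const Complex.continuous_re).mem_nhds (by simp)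
  filter_upwards [hV] with s hs
  exact (h₁.2 s hs).unique (h₂.2 s hs)

open Classical in
/-- The Hurwitz zeta function `ζ(s, z)` with complex second argument, defined for `s ≠ 1` as the
(unique) analytic continuation in `s` of `∑_{n ≥ 0} (z + n)^{-s}`. -/
noncomputable def hurwitzZetaComplex (s z : ℂ) : ℂ :=
  if h : ∃ g : ℂ → ℂ, IsHurwitzContinuation z g then h.choose s else 0

/-- `ζ^{(r)}(s, z) = ∂^r/∂s^r ζ(s, z)`. -/
noncomputable def hurwitzZetaDeriv (r : ℕ) (s z : ℂ) : ℂ :=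
  iteratedDeriv r (fun s' ↦ hurwitzZetaComplex s' z) s

/-- The function `x ↦ f(z) ζ^{(r)}(1 - k/2, z)`, `z = i/√N + x`, on the horizontal segment from
`i/√N` to `i/√N + 1`, parametrised by `x ∈ [0, 1]`. -/
noncomputable def hurwitzIntegrand {N k : ℕ} (f : CuspFormGamma0 N k) (r : ℕ) (x : ℝ) : ℂ :=
  f (UpperHalfPlane.ofComplex (Complex.I / √(N : ℝ) + x)) *
    hurwitzZetaDeriv r (1 - (k : ℂ) / 2) (Complex.I / √(N : ℝ) + x)

/-! Put `c = 1/√N` and `P(s) = ∫_c^∞ f(it) t^(s-1) dt`, an entire function (`partialMellin`). Two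
facts about `P` give the theorem.

Unfolding. For `Re s > 1`, periodicity of `f` turns `∫₀¹ f(ic+x) ζ(s, ic+x) dx` into the integral of
`f(z) z^(-s)` over the horizontal ray from `ic`. Cauchy's theorem rotates this ray to the vertical
one, which gives `i^(1-s) P(1-s)`. Both sides are holomorphic on `s ≠ 1`, so the equality persists
there (`integral_mul_hurwitzZetaComplex`) and may be differentiated in `s` at `1 - k/2`. This
requires `ζ(s, ic+x)` to be holomorphic in `s` and jointly continuous in `(s, x)`, which comes from
continuing the series one strip at a time.

Functional equation. Fricke invariance folds the part `t < c` of the Mellin integral of `f(it)` onto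
`t > c`. With `A(u) = N^(-u/2) P(k/2-u)` (`centeredMellin`) this reads `N^(u/2) Λ(k/2+u) = A(-u) +
i^k A(u)`, whose `m`-th derivative at `0` is `(i^k + (-1)^m) A^(m)(0)`. As the lower derivatives of
`L_f` vanish, the left side contributes only `(2π)^(-k/2) (k/2-1)! L_f^(m)(k/2)`.

Finally, `A(u)` is, up to the constant `i^(k/2)`, the product of `exp(u log(i/√N))` and the unfolded
integral at `1 - k/2 + u`. The Leibniz rule for this product is the sum over `j` in the statement.
-/

/-- A family of functions on `U ⊆ ℂ`, indexed by a real parameter, jointly continuous and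
holomorphic in the complex variable. -/
structure HolomorphicFamily (U : Set ℂ) (F : ℂ → ℝ → ℂ) : Prop where
  continuousOn : ContinuousOn (Function.uncurry F) (U ×ˢ Set.univ)
  differentiableOn : ∀ x, DifferentiableOn ℂ (fun s ↦ F s x) U

/-! ### Holomorphic functions depending continuously on a real parameter. -/

namespace HolomorphicFamily

open Filter Topology

variable {U : Set ℂ} {F G : ℂ → ℝ → ℂ}

theorem mono {V : Set ℂ} (hF : HolomorphicFamily U F) (h : V ⊆ U) : HolomorphicFamily V F :=
  ⟨hF.continuousOn.mono (Set.prod_mono h subset_rfl), fun x ↦ (hF.differentiableOn x).mono h⟩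

theorem congr (hF : HolomorphicFamily U F) (h : ∀ s ∈ U, ∀ x, G s x = F s x) :
    HolomorphicFamily U G :=
  ⟨hF.continuousOn.congr fun p hp ↦ h p.1 hp.1 p.2,
    fun x ↦ (hF.differentiableOn x).congr fun s hs ↦ h s hs x⟩

theorem mul (hF : HolomorphicFamily U F) (hG : HolomorphicFamily U G) :
    HolomorphicFamily U (fun s x ↦ F s x * G s x) :=
  ⟨hF.continuousOn.mul hG.continuousOn,
    fun x ↦ (hF.differentiableOn x).mul (hG.differentiableOn x)⟩

theorem add (hF : HolomorphicFamily U F) (hG : HolomorphicFamily U G) :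
    HolomorphicFamily U (fun s x ↦ F s x + G s x) :=
  ⟨hF.continuousOn.add hG.continuousOn,
    fun x ↦ (hF.differentiableOn x).add (hG.differentiableOn x)⟩

theorem of_differentiableOn {g : ℂ → ℂ} (hg : DifferentiableOn ℂ g U) :
    HolomorphicFamily U (fun s _ ↦ g s) :=
  ⟨hg.continuousOn.comp continuousOn_fst fun _ hp ↦ hp.1, fun _ ↦ hg⟩

theorem of_continuous {g : ℝ → ℂ} (hg : Continuous g) :
    HolomorphicFamily U (fun _ x ↦ g x) :=
  ⟨(hg.comp continuous_snd).continuousOn, fun _ ↦ differentiableOn_const _⟩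

theorem continuous_right (hF : HolomorphicFamily U F) {s : ℂ} (hs : s ∈ U) :
    Continuous (F s) := by
  have : Continuous (fun x : ℝ ↦ Function.uncurry F (s, x)) :=
    hF.continuousOn.comp_continuous (by fun_prop) fun x ↦ ⟨hs, trivial⟩
  exact this

theorem continuousAt (hF : HolomorphicFamily U F) (hU : IsOpen U) {s : ℂ} (hs : s ∈ U) (x : ℝ) :
    ContinuousAt (Function.uncurry F) (s, x) :=
  hF.continuousOn.continuousAt ((hU.prod isOpen_univ).mem_nhds ⟨hs, trivial⟩)

theorem tendstoLocallyUniformlyOn (hF : HolomorphicFamily U F) (hU : IsOpen U) (x₀ : ℝ) :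
    TendstoLocallyUniformlyOn (fun x s ↦ F s x) (fun s ↦ F s x₀) (𝓝 x₀) U := by
  rw [Metric.tendstoLocallyUniformlyOn_iff]
  intro ε hε s hs
  have h := Metric.continuousAt_iff'.mp (hF.continuousAt hU hs x₀) (ε / 2) (half_pos hε)
  rw [nhds_prod_eq] at h
  obtain ⟨p, hp, q, hq, hpq⟩ := eventually_prod_iff.mp h
  refine ⟨{y | p y}, mem_nhdsWithin_of_mem_nhds hp, ?_⟩
  filter_upwards [hq] with x hx y hy
  have h1 := hpq hy hx
  have h2 := hpq hy hq.self_of_nhds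
  simp only [Function.uncurry_apply_pair] at h1 h2
  calc dist (F y x₀) (F y x) ≤ dist (F y x₀) (F s x₀) + dist (F y x) (F s x₀) :=
        dist_triangle_right _ _ _
    _ < ε := by linarith

/-- By Weierstrass, locally uniform convergence in `s` as the parameter varies passes to
derivatives, so joint continuity survives differentiation. -/
theorem deriv (hF : HolomorphicFamily U F) (hU : IsOpen U) :
    HolomorphicFamily U (fun s x ↦ deriv (fun s' ↦ F s' x) s) := by
  refine ⟨?_, fun x ↦ (hF.differentiableOn x).deriv hU⟩
  rintro ⟨s, x⟩ ⟨hs, -⟩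
  refine ContinuousAt.continuousWithinAt ?_
  have hlim := (hF.tendstoLocallyUniformlyOn hU x).deriv
    (Eventually.of_forall fun x ↦ hF.differentiableOn x) hU
  refine tendsto_comp_of_locally_uniform_limit
    (f := _root_.deriv fun s' ↦ F s' x) (g := fun p : ℂ × ℝ ↦ p.1)
    (F := fun (p : ℂ × ℝ) ↦ _root_.deriv fun s' ↦ F s' p.2) (x := s) ?_ ?_ ?_
  · exact ((hF.differentiableOn x).deriv hU).continuousOn.continuousAt (hU.mem_nhds hs)
  · exact continuous_fst.continuousAt
  · intro u hu
    obtain ⟨t, ht, h⟩ := hlim u hu s hs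
    rw [hU.nhdsWithin_eq hs] at ht
    exact ⟨t, ht, (continuous_snd.tendsto (s, x)).eventually h⟩

theorem iteratedDeriv (hF : HolomorphicFamily U F) (hU : IsOpen U) (n : ℕ) :
    HolomorphicFamily U (fun s x ↦ iteratedDeriv n (fun s' ↦ F s' x) s) := by
  induction n with
  | zero => simpa using hF
  | succ n ih => simpa only [iteratedDeriv_succ] using ih.deriv hU

theorem hasDerivAt_integral (hF : HolomorphicFamily U F) (hU : IsOpen U) (a b : ℝ) {s : ℂ}
    (hs : s ∈ U) :
    HasDerivAt (fun s ↦ ∫ x in a..b, F s x) (∫ x in a..b, _root_.deriv (fun s' ↦ F s' x) s) s := by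
  obtain ⟨r, hr, hrU⟩ := Metric.nhds_basis_closedBall.mem_iff.mp (hU.mem_nhds hs)
  have hK : IsCompact (Metric.closedBall s r ×ˢ Set.uIcc a b) :=
    (isCompact_closedBall s r).prod isCompact_uIcc
  obtain ⟨C, hC⟩ := hK.exists_bound_of_continuousOn
    ((hF.deriv hU).continuousOn.mono (Set.prod_mono hrU (Set.subset_univ _)))
  refine (intervalIntegral.hasDerivAt_integral_of_dominated_loc_of_deriv_le
    (F' := fun s x ↦ _root_.deriv (fun s' ↦ F s' x) s) (bound := fun _ ↦ C)
    (Metric.closedBall_mem_nhds s hr) ?_ ?_ ?_ ?_ ?_ ?_).2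
  · filter_upwards [hU.mem_nhds hs] with y hy
    exact (hF.continuous_right hy).aestronglyMeasurable
  · exact (hF.continuous_right hs).intervalIntegrable _ _
  · exact ((hF.deriv hU).continuous_right hs).aestronglyMeasurable
  · exact Eventually.of_forall fun x hx y hy ↦ hC (y, x) ⟨hy, Set.uIoc_subset_uIcc hx⟩
  · simp
  · exact Eventually.of_forall fun x _ y hy ↦
      ((hF.differentiableOn x).differentiableAt (hU.mem_nhds (hrU hy))).hasDerivAt

theorem differentiableOn_integral (hF : HolomorphicFamily U F) (hU : IsOpen U) (a b : ℝ) :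
    DifferentiableOn ℂ (fun s ↦ ∫ x in a..b, F s x) U := fun _ hs ↦
  (hF.hasDerivAt_integral hU a b hs).differentiableAt.differentiableWithinAt

theorem iteratedDeriv_integral (hF : HolomorphicFamily U F) (hU : IsOpen U) (a b : ℝ) (n : ℕ)
    {s : ℂ} (hs : s ∈ U) :
    _root_.iteratedDeriv n (fun s ↦ ∫ x in a..b, F s x) s =
      ∫ x in a..b, _root_.iteratedDeriv n (fun s' ↦ F s' x) s := by
  induction n generalizing s with
  | zero => simp
  | succ n ih =>
    simp only [iteratedDeriv_succ]
    have h : _root_.iteratedDeriv n (fun s ↦ ∫ x in a..b, F s x) =ᶠ[𝓝 s]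
        fun s ↦ ∫ x in a..b, _root_.iteratedDeriv n (fun s' ↦ F s' x) s := by
      filter_upwards [hU.mem_nhds hs] with y hy using ih hy
    rw [h.deriv_eq, ((hF.iteratedDeriv hU n).hasDerivAt_integral hU a b hs).deriv]

/-- Averaging a holomorphic family against a weight over translates of both variables. -/
theorem integral_shift (hF : HolomorphicFamily U F) (hU : IsOpen U) {g : ℝ → ℂ}
    (hg : Continuous g) (c : ℂ) (a b : ℝ) :
    HolomorphicFamily ((fun s ↦ s + c) ⁻¹' U)
      (fun s x ↦ ∫ t in a..b, g t * F (s + c) (x + t)) := by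
  have hV : IsOpen ((fun s ↦ s + c) ⁻¹' U) := hU.preimage (by fun_prop)
  refine ⟨?_, fun x ↦ ?_⟩
  · rw [continuousOn_iff_continuous_domRestrict]
    refine intervalIntegral.continuous_parametric_intervalIntegral_of_continuous'
      (f := fun (p : {p : ℂ × ℝ // p ∈ ((fun s ↦ s + c) ⁻¹' U) ×ˢ (Set.univ : Set ℝ)}) t ↦
        g t * F (p.1.1 + c) (p.1.2 + t)) ?_ a b
    refine (hg.comp continuous_snd).mul ?_
    exact hF.continuousOn.comp_continuous
      (f := fun q : {p : ℂ × ℝ // p ∈ ((fun s ↦ s + c) ⁻¹' U) ×ˢ (Set.univ : Set ℝ)} × ℝ ↦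
        (q.1.1.1 + c, q.1.1.2 + q.2)) (by fun_prop) fun q ↦ ⟨q.1.2.1, trivial⟩
  · refine HolomorphicFamily.differentiableOn_integral
      (F := fun s t ↦ g t * F (s + c) (x + t)) ⟨?_, fun t ↦ ?_⟩ hV a b
    · refine (hg.comp continuous_snd).continuousOn.mul ?_
      exact hF.continuousOn.comp (f := fun q : ℂ × ℝ ↦ (q.1 + c, x + q.2)) (by fun_prop)
        fun q hq ↦ ⟨hq.1, trivial⟩
    · exact ((hF.differentiableOn (x + t)).comp (f := fun s ↦ s + c) (by fun_prop)
        fun s hs ↦ hs).const_mul _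

end HolomorphicFamily

/-! ### Analytic continuation of the Hurwitz series along a horizontal line. -/

section HurwitzSeries

open Filter Topology

variable {w : ℂ}

theorem add_ofReal_add_natCast_mem_slitPlane (hw : 0 < w.im) (x : ℝ) (n : ℕ) :
    w + x + n ∈ Complex.slitPlane :=
  Complex.mem_slitPlane_iff.mpr (.inr (by simpa using hw.ne'))

/-- The real part controls `n` up to a bounded error, and the imaginary part, at least `w.im`,
absorbs that error. -/
theorem natCast_add_one_le_mul_norm (hw : 0 < w.im) {X x : ℝ} (hx : |x| ≤ X) (n : ℕ) :
    (n + 1 : ℝ) ≤ (1 + (X + |w.re| + 1) / w.im) * ‖w + x + n‖ := by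
  have h1 : w.re + x + n ≤ ‖w + x + n‖ := by simpa using Complex.re_le_norm (w + x + n)
  have h2 : w.im ≤ ‖w + x + n‖ := by simpa using Complex.im_le_norm (w + x + n)
  have h3 := abs_le.mp hx
  have h4 := neg_abs_le w.re
  have h5 : X + |w.re| + 1 ≤ (X + |w.re| + 1) / w.im * ‖w + x + n‖ := by
    rw [div_mul_eq_mul_div, le_div_iff₀ hw]
    have : 0 ≤ X := (abs_nonneg x).trans hx
    gcongr
  linarith

theorem exists_norm_cpow_neg_le (hw : 0 < w.im) {a : ℝ} (ha : 0 ≤ a) (R X : ℝ) :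
    ∃ C, 0 ≤ C ∧ ∀ s : ℂ, a ≤ s.re → ‖s‖ ≤ R → ∀ x : ℝ, |x| ≤ X → ∀ n : ℕ,
      ‖(w + x + n) ^ (-s)‖ ≤ C * (n + 1 : ℝ) ^ (-a) := by
  set D : ℝ := 1 + (X + |w.re| + 1) / w.im with hD
  refine ⟨|D| ^ R * Real.exp (π * R), by positivity, fun s hs hsR x hx n ↦ ?_⟩
  have hX : 0 ≤ X := (abs_nonneg x).trans hx
  have hD1 : 1 ≤ D := by
    rw [hD, le_add_iff_nonneg_right]
    positivity
  have hD0 : 0 < D := one_pos.trans_le hD1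
  have hn : (0 : ℝ) < n + 1 := by positivity
  have hle := natCast_add_one_le_mul_norm hw hx n
  rw [← hD] at hle
  have hsre : s.re ≤ R := (Complex.re_le_norm s).trans hsR
  have hz : 0 < ‖w + x + n‖ :=
    norm_pos_iff.mpr (Complex.slitPlane_ne_zero (add_ofReal_add_natCast_mem_slitPlane hw x n))
  have h1 : ‖w + x + n‖ ^ (-s.re) ≤ D ^ R * (n + 1 : ℝ) ^ (-a) := by
    calc ‖w + x + n‖ ^ (-s.re) ≤ ((n + 1) / D) ^ (-s.re) := by
          refine Real.rpow_le_rpow_of_nonpos (by positivity) ?_ (by linarith)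
          rwa [div_le_iff₀' hD0]
      _ = D ^ s.re * (n + 1 : ℝ) ^ (-s.re) := by
          rw [Real.div_rpow hn.le hD0.le, Real.rpow_neg hD0.le, div_inv_eq_mul, mul_comm]
      _ ≤ D ^ R * (n + 1 : ℝ) ^ (-a) := by
          refine mul_le_mul (Real.rpow_le_rpow_of_exponent_le hD1 hsre)
            (Real.rpow_le_rpow_of_exponent_le (by simp) (neg_le_neg hs)) ?_ ?_ <;> positivity
  have h2 : Real.exp (-(Complex.arg (w + x + n) * (-s).im)) ≤ Real.exp (π * R) := by
    rw [Real.exp_le_exp]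
    calc -(Complex.arg (w + x + n) * (-s).im) ≤ |Complex.arg (w + x + n)| * |s.im| := by
          rw [Complex.neg_im, mul_neg, neg_neg, ← abs_mul]
          exact le_abs_self _
      _ ≤ π * R := by
          gcongr
          · exact Complex.abs_arg_le_pi _
          · exact (Complex.abs_im_le_norm s).trans hsR
  calc ‖(w + x + n) ^ (-s)‖
      ≤ ‖w + x + n‖ ^ (-s).re / Real.exp (Complex.arg (w + x + n) * (-s).im) :=
        Complex.norm_cpow_le _ _
    _ = ‖w + x + n‖ ^ (-s.re) * Real.exp (-(Complex.arg (w + x + n) * (-s).im)) := by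
        rw [Complex.neg_re, Real.exp_neg, div_eq_mul_inv]
    _ ≤ D ^ R * (n + 1 : ℝ) ^ (-a) * Real.exp (π * R) := by gcongr
    _ = _ := by rw [abs_of_pos hD0]; ring

theorem summable_natCast_add_one_rpow {a : ℝ} (ha : 1 < a) :
    Summable fun n : ℕ ↦ (n + 1 : ℝ) ^ (-a) := by
  have := (summable_nat_add_iff 1).mpr (Real.summable_nat_rpow.mpr (neg_lt_neg ha))
  simpa using this

theorem summable_cpow_neg (hw : 0 < w.im) {s : ℂ} (hs : 1 < s.re) (x : ℝ) :
    Summable fun n : ℕ ↦ (w + x + n) ^ (-s) := by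
  obtain ⟨C, -, hC⟩ := exists_norm_cpow_neg_le hw (zero_le_one.trans hs.le) ‖s‖ |x|
  exact ((summable_natCast_add_one_rpow hs).mul_left C).of_norm_bounded
    fun n ↦ hC s le_rfl le_rfl x le_rfl n

theorem holomorphicFamily_cpow (hw : 0 < w.im) (n : ℕ) {e : ℂ → ℂ} (he : Differentiable ℂ e) :
    HolomorphicFamily Set.univ fun s x ↦ (w + x + n) ^ e s := by
  refine ⟨ContinuousOn.cpow (by fun_prop) ?_ fun p _ ↦
    add_ofReal_add_natCast_mem_slitPlane hw p.2 n, fun x s _ ↦ ?_⟩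
  · exact (he.continuous.comp continuous_fst).continuousOn
  · exact ((he s).const_cpow (.inl (Complex.slitPlane_ne_zero
      (add_ofReal_add_natCast_mem_slitPlane hw x n)))).differentiableWithinAt

theorem holomorphicFamily_tsum_cpow (hw : 0 < w.im) :
    HolomorphicFamily {s | 1 < s.re} fun s x ↦ ∑' n : ℕ, (w + x + n) ^ (-s) := by
  -- A summable majorant uniform near `(s₀, x₀)`, with an exponent chosen strictly between `1` and
  -- `Re s₀`; it yields both continuity and holomorphy.
  have key : ∀ s₀ : ℂ, 1 < s₀.re → ∀ x₀ : ℝ, ∃ V : Set ℂ, IsOpen V ∧ s₀ ∈ V ∧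
      ∃ u : ℕ → ℝ, Summable u ∧ ∀ n : ℕ, ∀ s ∈ V, ∀ x ∈ Metric.ball x₀ 1,
        ‖(w + x + n) ^ (-s)‖ ≤ u n := by
    intro s₀ hs₀ x₀
    obtain ⟨a, ha1, ha⟩ := exists_between hs₀
    obtain ⟨C, -, hC⟩ := exists_norm_cpow_neg_le hw (zero_le_one.trans ha1.le) (‖s₀‖ + 1) (|x₀| + 1)
    refine ⟨{s | a < s.re} ∩ Metric.ball s₀ 1,
      (isOpen_lt continuous_const Complex.continuous_re).inter Metric.isOpen_ball,
      ⟨ha, by simp⟩, _, (summable_natCast_add_one_rpow ha1).mul_left C, fun n s hs x hx ↦ ?_⟩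
    refine hC s hs.1.le ?_ x ?_ n
    · have h := hs.2
      rw [mem_ball_iff_norm] at h
      have := norm_le_norm_add_norm_sub' s s₀
      linarith
    · rw [mem_ball_iff_norm, Real.norm_eq_abs] at hx
      have := norm_le_norm_add_norm_sub' x x₀
      simp only [Real.norm_eq_abs] at this
      linarith
  refine ⟨?_, fun x s hs ↦ ?_⟩
  · rintro ⟨s₀, x₀⟩ ⟨hs₀, -⟩
    obtain ⟨V, hV, hsV, u, hu, hb⟩ := key s₀ hs₀ x₀
    refine ContinuousAt.continuousWithinAt ?_
    have : ContinuousOn (fun p : ℂ × ℝ ↦ ∑' n : ℕ, (w + p.2 + n) ^ (-p.1))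
        (V ×ˢ Metric.ball x₀ 1) :=
      continuousOn_tsum (fun n ↦ (holomorphicFamily_cpow hw n differentiable_neg).continuousOn.mono
        (Set.prod_mono (Set.subset_univ _) (Set.subset_univ _))) hu
        fun n p hp ↦ hb n p.1 hp.1 p.2 hp.2
    exact this.continuousAt ((hV.prod Metric.isOpen_ball).mem_nhds ⟨hsV, by simp⟩)
  · obtain ⟨V, hV, hsV, u, hu, hb⟩ := key s hs x
    exact ((Complex.differentiableOn_tsum_of_summable_norm hu
      (fun n ↦ ((holomorphicFamily_cpow hw n differentiable_neg).differentiableOn x).mono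
        (Set.subset_univ _)) hV fun n s hs ↦ hb n s hs x (by simp)).differentiableAt
        (hV.mem_nhds hsV)).differentiableWithinAt

/-- The first-order Euler–Maclaurin identity for `t ↦ (z + t) ^ (-s)` on `[0, 1]`. -/
theorem integral_one_sub_mul_cpow {z : ℂ} (hz : 0 < z.im) {s : ℂ} (hs : s ≠ 1) :
    ∫ t in (0 : ℝ)..1, (1 - t : ℂ) * (s * (z + t) ^ (-(s + 1))) =
      z ^ (-s) + ((z + 1) ^ (1 - s) - z ^ (1 - s)) / (s - 1) := by
  have hs' : (1 - s) ≠ 0 := sub_ne_zero.mpr hs.symm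
  have hs'' : (s - 1) ≠ 0 := sub_ne_zero.mpr hs
  have hmem : ∀ t : ℝ, z + t ∈ Complex.slitPlane := fun t ↦ by
    simpa using add_ofReal_add_natCast_mem_slitPlane hz t 0
  -- The antiderivative comes from integrating by parts against `1 - t`, whose boundary term
  -- vanishes at `t = 1`.
  have hd : ∀ t ∈ Set.uIcc (0 : ℝ) 1, HasDerivAt
      (fun t : ℝ ↦ -((1 - t : ℂ) * (z + t) ^ (-s)) - (z + t) ^ (1 - s) / (1 - s))
      ((1 - t : ℂ) * (s * (z + t) ^ (-(s + 1)))) t := by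
    intro t _
    have h0 : HasDerivAt (fun t : ℝ ↦ z + t) 1 t :=
      (Complex.ofRealCLM.hasDerivAt (x := t)).const_add z
    have h1 : HasDerivAt (fun t : ℝ ↦ (1 - t : ℂ)) (-1) t :=
      (Complex.ofRealCLM.hasDerivAt (x := t)).const_sub 1
    have h2 := fun e : ℂ ↦ ((hasDerivAt_id (z + t : ℂ)).cpow_const (c := e) (hmem t)).comp t h0
    convert! ((h1.mul (h2 (-s))).neg.sub ((h2 (1 - s)).div_const (1 - s))) using 1
    simp only [id, Function.comp]
    rw [show -s - 1 = -(s + 1) by ring, show 1 - s - 1 = -s by ring]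
    field_simp
    ring
  have hc : Continuous fun t : ℝ ↦ (1 - t : ℂ) * (s * (z + t) ^ (-(s + 1))) := by
    refine Continuous.mul (by fun_prop) (continuous_const.mul ?_)
    exact Continuous.cpow (by fun_prop) continuous_const hmem
  rw [intervalIntegral.integral_eq_sub_of_hasDerivAt hd (hc.intervalIntegrable _ _)]
  simp only [Complex.ofReal_one, Complex.ofReal_zero, sub_self, zero_mul, add_zero, sub_zero,
    one_mul, neg_zero]
  field_simp
  ring

theorem tendsto_cpow_neg_atTop (hw : 0 < w.im) {s : ℂ} (hs : 0 < s.re) (x : ℝ) :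
    Tendsto (fun n : ℕ ↦ (w + x + n) ^ (-s)) atTop (𝓝 0) := by
  obtain ⟨C, -, hC⟩ := exists_norm_cpow_neg_le hw hs.le ‖s‖ |x|
  refine squeeze_zero_norm (fun n ↦ hC s le_rfl le_rfl x le_rfl n) ?_
  rw [← mul_zero C]
  refine ((tendsto_rpow_neg_atTop hs).comp ?_).const_mul C
  exact tendsto_atTop_add_const_right _ _ tendsto_natCast_atTop_atTop

/-- Summing the Euler–Maclaurin identity over `z = w + x + n` makes the boundary powers telescope.
The right side involves the series only at `s + 1`, so it makes sense one strip further left. -/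
theorem tsum_cpow_neg_eq (hw : 0 < w.im) {s : ℂ} (hs : 1 < s.re) (x : ℝ) :
    (s - 1) * ∑' n : ℕ, (w + x + n) ^ (-s) =
      (w + x) ^ (1 - s) + (s - 1) * ∫ t in (0 : ℝ)..1,
        (1 - t : ℂ) * (s * ∑' n : ℕ, (w + ((x + t : ℝ) : ℂ) + n) ^ (-(s + 1))) := by
  have hs1 : s ≠ 1 := by rintro rfl; simp at hs
  have hs'' : (s - 1) ≠ 0 := sub_ne_zero.mpr hs1
  -- Decay of order `Re s`, weaker than the available `Re s + 1`, already suffices for summability;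
  -- `|x| + 1` covers `x + t` with `t ≤ 1`.
  obtain ⟨C, hC0, hC⟩ := exists_norm_cpow_neg_le hw (zero_le_one.trans hs.le) ‖s + 1‖ (|x| + 1)
  have hcast : ∀ (t : ℝ) (n : ℕ), w + ((x + t : ℝ) : ℂ) + n = (w + x + n) + t := fun t n ↦ by
    push_cast; ring
  have hsum : HasSum (fun n : ℕ ↦ ∫ t in (0 : ℝ)..1, (1 - t : ℂ) *
      (s * (w + ((x + t : ℝ) : ℂ) + n) ^ (-(s + 1))))
      (∫ t in (0 : ℝ)..1,
        (1 - t : ℂ) * (s * ∑' n : ℕ, (w + ((x + t : ℝ) : ℂ) + n) ^ (-(s + 1)))) := by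
    refine intervalIntegral.hasSum_integral_of_dominated_convergence
      (fun n _ ↦ ‖s‖ * (C * (n + 1 : ℝ) ^ (-s.re))) (fun n ↦ ?_) (fun n ↦ ?_) ?_ ?_ ?_
    · refine Continuous.aestronglyMeasurable ?_
      refine Continuous.mul (by fun_prop) (continuous_const.mul ?_)
      exact Continuous.cpow (by fun_prop) continuous_const
        fun t ↦ add_ofReal_add_natCast_mem_slitPlane hw (x + t) n
    · refine Eventually.of_forall fun t ht ↦ ?_
      rw [Set.uIoc_of_le zero_le_one] at ht
      have h1 : ‖(1 - t : ℂ)‖ ≤ 1 := by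
        rw [← Complex.ofReal_one, ← Complex.ofReal_sub, Complex.norm_real, Real.norm_eq_abs, abs_le]
        constructor <;> linarith [ht.1, ht.2]
      have h2 := hC (s + 1) (by simp) le_rfl (x + t) (by
        refine (abs_add_le _ _).trans ?_
        gcongr
        exact abs_le.mpr ⟨by linarith [ht.1], ht.2⟩) n
      rw [norm_mul, norm_mul]
      calc _ ≤ 1 * (‖s‖ * (C * (n + 1 : ℝ) ^ (-s.re))) := by gcongr
        _ = _ := one_mul _
    · exact Eventually.of_forall fun t _ ↦
        ((summable_natCast_add_one_rpow hs).mul_left C).mul_left ‖s‖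
    · simp
    · refine Eventually.of_forall fun t _ ↦ ?_
      exact ((summable_cpow_neg hw (s := s + 1) (by simp; linarith) (x + t)).hasSum.mul_left
        s).mul_left _
  have hterm : ∀ n : ℕ, ∫ t in (0 : ℝ)..1, (1 - t : ℂ) *
      (s * (w + ((x + t : ℝ) : ℂ) + n) ^ (-(s + 1))) =
      (w + x + n) ^ (-s) +
        ((w + x + (n + 1 : ℕ)) ^ (1 - s) - (w + x + n) ^ (1 - s)) / (s - 1) := by
    intro n
    simp_rw [hcast]
    rw [integral_one_sub_mul_cpow (by simpa using hw) hs1]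
    push_cast
    rw [add_assoc (w + (x : ℂ))]
  simp_rw [hterm] at hsum
  have hlim := hsum.tendsto_sum_nat
  simp_rw [Finset.sum_add_distrib, ← Finset.sum_div] at hlim
  have htel : ∀ m : ℕ, ∑ n ∈ Finset.range m,
      ((w + x + (n + 1 : ℕ)) ^ (1 - s) - (w + x + n) ^ (1 - s)) =
      (w + x + m) ^ (1 - s) - (w + x) ^ (1 - s) := fun m ↦ by
    rw [Finset.sum_range_sub fun n : ℕ ↦ (w + x + n) ^ (1 - s)]
    simp
  simp_rw [htel] at hlim
  have hz := tendsto_cpow_neg_atTop hw (s := s - 1) (by simpa using hs) x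
  simp only [neg_sub] at hz
  have hlim' := (summable_cpow_neg hw hs x).hasSum.tendsto_sum_nat.add
    ((hz.sub_const ((w + x) ^ (1 - s))).div_const (s - 1))
  rw [tendsto_nhds_unique hlim hlim']
  field_simp
  ring

/-- The factor `s - 1` removes the pole. It also turns the `s ζ(s+1, ·)` of the recursion into the
previous `Z (s + 1)`, so each induction step gains a strip of width one. -/
theorem exists_holomorphicFamily_hurwitz_halfPlane (hw : 0 < w.im) (K : ℕ) :
    ∃ Z : ℂ → ℝ → ℂ, HolomorphicFamily {s | 1 - (K : ℝ) < s.re} Z ∧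
      ∀ s : ℂ, 1 < s.re → ∀ x : ℝ, Z s x = (s - 1) * ∑' n : ℕ, (w + x + n) ^ (-s) := by
  induction K with
  | zero =>
    refine ⟨_, ?_, fun _ _ _ ↦ rfl⟩
    simp only [CharP.cast_eq_zero, sub_zero]
    exact (HolomorphicFamily.of_differentiableOn (by fun_prop)).mul (holomorphicFamily_tsum_cpow hw)
  | succ K ih =>
    obtain ⟨Z, hZ, hZs⟩ := ih
    refine ⟨fun s x ↦ (w + x + (0 : ℕ)) ^ (1 - s) +
      (s - 1) * ∫ t in (0 : ℝ)..1, (1 - t : ℂ) * Z (s + 1) (x + t), ?_, fun s hs x ↦ ?_⟩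
    · refine ((holomorphicFamily_cpow hw 0 (by fun_prop)).mono (Set.subset_univ _)).add
        ((HolomorphicFamily.of_differentiableOn (by fun_prop)).mul
          ((hZ.integral_shift (g := fun t ↦ (1 - t : ℂ)) ?_ (by fun_prop) 1 0 1).mono ?_))
      · exact isOpen_lt continuous_const Complex.continuous_re
      · intro s hs
        simp only [Set.mem_ofPred_eq, Nat.cast_add, Nat.cast_one, Set.mem_preimage, Complex.add_re,
          Complex.one_re] at hs ⊢
        linarith
    · rw [tsum_cpow_neg_eq hw hs]
      have : ∀ t : ℝ, Z (s + 1) (x + t) =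
          s * ∑' n : ℕ, (w + ((x + t : ℝ) : ℂ) + n) ^ (-(s + 1)) := fun t ↦ by
        rw [hZs (s + 1) (by simp; linarith), add_sub_cancel_right]
      simp [this]

theorem exists_holomorphicFamily_hurwitz (hw : 0 < w.im) :
    ∃ Z : ℂ → ℝ → ℂ, HolomorphicFamily Set.univ Z ∧
      ∀ s : ℂ, 1 < s.re → ∀ x : ℝ, Z s x = (s - 1) * ∑' n : ℕ, (w + x + n) ^ (-s) := by
  choose Z hZ hZs using exists_holomorphicFamily_hurwitz_halfPlane hw
  have hopen : ∀ K : ℕ, IsOpen {s : ℂ | 1 - (K : ℝ) < s.re} := fun K ↦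
    isOpen_lt continuous_const Complex.continuous_re
  have hmono : ∀ {K L : ℕ}, K ≤ L → ∀ s : ℂ, 1 - (K : ℝ) < s.re → ∀ x, Z L s x = Z K s x := by
    intro K L hKL s hs x
    have hsub : {s : ℂ | 1 - (K : ℝ) < s.re} ⊆ {s : ℂ | 1 - (L : ℝ) < s.re} := fun s hs ↦ by
      have : (K : ℝ) ≤ L := mod_cast hKL
      simp only [Set.mem_ofPred_eq] at hs ⊢
      linarith
    have h2 : (2 : ℂ) ∈ {s : ℂ | 1 - (K : ℝ) < s.re} := by
      have : (0 : ℝ) ≤ K := K.cast_nonneg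
      simp
      linarith
    refine ((((hZ L).differentiableOn x).mono hsub).analyticOnNhd
      (hopen K)).eqOn_of_preconnected_of_eventuallyEq
      (((hZ K).differentiableOn x).analyticOnNhd (hopen K))
      (convex_halfSpace_re_gt _).isPreconnected h2 ?_ hs
    have hV : {s : ℂ | 1 < s.re} ∈ 𝓝 (2 : ℂ) :=
      (isOpen_lt continuous_const Complex.continuous_re).mem_nhds (by simp)
    filter_upwards [hV] with s hs
    rw [hZs L s hs, hZs K s hs]
  -- Index of a half-plane containing `s`; by `hmono` the glued function does not depend on this
  -- choice.
  set k : ℂ → ℕ := fun s ↦ ⌈1 - s.re⌉₊ + 1 with hk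
  have hks : ∀ s : ℂ, 1 - (k s : ℝ) < s.re := fun s ↦ by
    have := Nat.le_ceil (1 - s.re)
    simp only [hk, Nat.cast_add, Nat.cast_one]
    linarith
  have hZk : ∀ (K : ℕ) (s : ℂ), 1 - (K : ℝ) < s.re → ∀ x, Z (k s) s x = Z K s x := by
    intro K s hs x
    rcases le_total K (k s) with h | h
    · exact hmono h s hs x
    · exact (hmono h s (hks s) x).symm
  have hfam : ∀ K : ℕ, HolomorphicFamily {s : ℂ | 1 - (K : ℝ) < s.re} fun s x ↦ Z (k s) s x :=
    fun K ↦ (hZ K).congr (hZk K)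
  refine ⟨fun s x ↦ Z (k s) s x, ⟨?_, fun x s _ ↦ ?_⟩, fun s hs x ↦ hZs _ s hs x⟩
  · rintro ⟨s, x⟩ -
    exact ((hfam (k s)).continuousAt (hopen _) (hks s) x).continuousWithinAt
  · exact (((hfam (k s)).differentiableOn x).differentiableAt
      ((hopen _).mem_nhds (hks s))).differentiableWithinAt

theorem hurwitzZetaComplex_isHurwitzContinuation {z : ℂ} {g : ℂ → ℂ}
    (hg : IsHurwitzContinuation z g) :
    IsHurwitzContinuation z fun s ↦ hurwitzZetaComplex s z := by
  have h : ∃ g, IsHurwitzContinuation z g := ⟨g, hg⟩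
  have := h.choose_spec
  simpa only [hurwitzZetaComplex, dif_pos h] using this

theorem exists_isHurwitzContinuation (hw : 0 < w.im) :
    ∃ F : ℂ → ℝ → ℂ, HolomorphicFamily {1}ᶜ F ∧
      ∀ x : ℝ, IsHurwitzContinuation (w + x) fun s ↦ F s x := by
  obtain ⟨Z, hZ, hZs⟩ := exists_holomorphicFamily_hurwitz hw
  have hF : HolomorphicFamily {1}ᶜ fun s x ↦ (s - 1)⁻¹ * Z s x := by
    refine (HolomorphicFamily.of_differentiableOn (DifferentiableOn.inv (by fun_prop) ?_)).mul
      (hZ.mono (Set.subset_univ _))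
    exact fun s hs ↦ sub_ne_zero.mpr hs
  refine ⟨_, hF, fun x ↦ ⟨hF.differentiableOn x, fun s hs ↦ ?_⟩⟩
  have hs1 : s - 1 ≠ 0 := sub_ne_zero.mpr (by rintro rfl; simp at hs)
  simp only
  rw [hZs s hs x, inv_mul_cancel_left₀ hs1]
  exact (summable_cpow_neg hw hs x).hasSum

theorem isHurwitzContinuation_hurwitzZetaComplex (hw : 0 < w.im) (x : ℝ) :
    IsHurwitzContinuation (w + x) fun s ↦ hurwitzZetaComplex s (w + x) := by
  obtain ⟨F, -, hF⟩ := exists_isHurwitzContinuation hw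
  exact hurwitzZetaComplex_isHurwitzContinuation (hF x)

/-- The continuation is chosen separately for each `x`, so regularity in `x` must be transferred
from the constructed family by uniqueness. -/
theorem holomorphicFamily_hurwitzZetaComplex (hw : 0 < w.im) :
    HolomorphicFamily {1}ᶜ fun s x ↦ hurwitzZetaComplex s (w + x) := by
  obtain ⟨F, hF, hFc⟩ := exists_isHurwitzContinuation hw
  exact hF.congr fun s hs x ↦ (isHurwitzContinuation_hurwitzZetaComplex hw x).eqOn (hFc x) hs

end HurwitzSeries

/-! ### Unfolding, and rotation of the contour to the imaginary axis. -/

section ContourShift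

open Filter Topology MeasureTheory

theorem norm_cpow_neg_le_of_le_norm {z s : ℂ} (hs : 0 ≤ s.re) {r : ℝ} (hr : 0 < r) (hz : r ≤ ‖z‖) :
    ‖z ^ (-s)‖ ≤ Real.exp (π * |s.im|) * r ^ (-s.re) := by
  have h2 : Real.exp (-(Complex.arg z * (-s).im)) ≤ Real.exp (π * |s.im|) := by
    rw [Real.exp_le_exp]
    calc -(Complex.arg z * (-s).im) ≤ |Complex.arg z| * |s.im| := by
          rw [Complex.neg_im, mul_neg, neg_neg, ← abs_mul]
          exact le_abs_self _
      _ ≤ π * |s.im| := by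
          gcongr
          exact Complex.abs_arg_le_pi _
  calc ‖z ^ (-s)‖ ≤ ‖z‖ ^ (-s).re / Real.exp (Complex.arg z * (-s).im) :=
        Complex.norm_cpow_le _ _
    _ = Real.exp (-(Complex.arg z * (-s).im)) * ‖z‖ ^ (-s.re) := by
        rw [Complex.neg_re, Real.exp_neg, div_eq_inv_mul]
    _ ≤ _ := by
        exact mul_le_mul h2 (Real.rpow_le_rpow_of_nonpos hr hz (neg_nonpos.mpr hs))
          (by positivity) (by positivity)

/-- Moving a horizontal contour to the imaginary axis, for `ψ(z) z ^ (-s)` with `ψ` holomorphic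
on the upper half-plane and bounded on the region above the contour. -/
theorem tendsto_integral_horizontal {ψ : ℂ → ℂ} (hψ : DifferentiableOn ℂ ψ {z | 0 < z.im})
    {c : ℝ} (hc : 0 < c) {M : ℝ} (hM : ∀ z : ℂ, c ≤ z.im → ‖ψ z‖ ≤ M) {s : ℂ} (hs : 1 < s.re)
    (hint : IntegrableOn (fun y : ℝ ↦ ψ (Complex.I * y) * (Complex.I * y) ^ (-s)) (Set.Ioi c)) :
    Tendsto (fun n : ℕ ↦ ∫ x in (0 : ℝ)..n, ψ (Complex.I * c + x) * (Complex.I * c + x) ^ (-s))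
      atTop (𝓝 (Complex.I * ∫ y in Set.Ioi c, ψ (Complex.I * y) * (Complex.I * y) ^ (-s))) := by
  set g : ℂ → ℂ := fun z ↦ ψ z * z ^ (-s) with hg
  have hgd : DifferentiableOn ℂ g {z | 0 < z.im} := by
    refine hψ.mul fun z hz ↦ ?_
    exact (differentiableAt_id.cpow_const
      (Complex.mem_slitPlane_iff.mpr (.inr (ne_of_gt hz)))).differentiableWithinAt
  have hs0 : 0 ≤ s.re := zero_le_one.trans hs.le
  have hM0 : 0 ≤ M := (norm_nonneg _).trans (hM (c * Complex.I) (by simp))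
  set B : ℝ := M * Real.exp (π * |s.im|) with hB
  -- The rectangle has corners `ic` and `n + i(c+n)`. Its top and right sides have length `n` and
  -- lie at distance at least `n` from `0`, so each contributes `O(n^(1 - Re s))`.
  have hgb : ∀ (n : ℕ), 0 < n → ∀ z : ℂ, c ≤ z.im → (n : ℝ) ≤ ‖z‖ →
      ‖g z‖ ≤ B * (n : ℝ) ^ (-s.re) := by
    intro n hn z hz hzn
    rw [hg, norm_mul, hB, mul_assoc]
    exact mul_le_mul (hM z hz) (norm_cpow_neg_le_of_le_norm hs0 (by positivity) hzn)
      (norm_nonneg _) hM0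
  have hrect : ∀ n : ℕ, ∫ x in (0 : ℝ)..n, g (Complex.I * c + x) =
      (∫ x in (0 : ℝ)..n, g (x + (c + n : ℝ) * Complex.I)) -
        Complex.I * (∫ y in c..(c + n : ℝ), g (n + y * Complex.I)) +
        Complex.I * ∫ y in c..(c + n : ℝ), g (Complex.I * y) := by
    intro n
    have h := Complex.integral_boundary_rect_eq_zero_of_differentiableOn g
      (c * Complex.I) (n + (c + n : ℝ) * Complex.I) (hgd.mono ?_)
    · simp only [Complex.mul_re, Complex.mul_im, Complex.add_re, Complex.add_im, Complex.natCast_re,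
        Complex.natCast_im, Complex.ofReal_re, Complex.ofReal_im, Complex.I_re, Complex.I_im,
        mul_zero, mul_one, sub_zero, add_zero, zero_add, smul_eq_mul,
        Complex.ofReal_zero, Complex.ofReal_natCast] at h
      have e1 : ∀ x : ℝ, Complex.I * c + x = x + c * Complex.I := fun x ↦ by ring
      have e2 : ∀ y : ℝ, Complex.I * y = y * Complex.I := fun y ↦ mul_comm _ _
      simp_rw [e1]
      simp_rw [e2]
      linear_combination h
    · intro z hz
      have h2 := (Complex.mem_reProdIm.mp hz).2
      simp only [Complex.mul_im, Complex.ofReal_re, Complex.I_im, mul_one, Complex.ofReal_im,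
        Complex.I_re, mul_zero, add_zero, Complex.add_im, Complex.natCast_im, zero_add] at h2
      rw [Set.uIcc_of_le (by simp)] at h2
      exact hc.trans_le h2.1
  have hzero : Tendsto (fun n : ℕ ↦ B * (n : ℝ) ^ (-s.re) * n) atTop (𝓝 0) := by
    have : Tendsto (fun n : ℕ ↦ B * (n : ℝ) ^ (-(s.re - 1))) atTop (𝓝 (B * 0)) :=
      ((tendsto_rpow_neg_atTop (sub_pos.mpr hs)).comp tendsto_natCast_atTop_atTop).const_mul B
    rw [mul_zero] at this
    refine this.congr' ?_
    filter_upwards [eventually_gt_atTop 0] with n hn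
    rw [mul_assoc B, ← Real.rpow_add_one (by positivity)]
    congr 2
    ring
  have htop : Tendsto (fun n : ℕ ↦ ∫ x in (0 : ℝ)..n, g (x + (c + n : ℝ) * Complex.I))
      atTop (𝓝 0) := by
    refine squeeze_zero_norm' ?_ hzero
    filter_upwards [eventually_gt_atTop 0] with n hn
    refine (intervalIntegral.norm_integral_le_of_norm_le_const fun x _ ↦
      hgb n hn _ (by simp) ?_).trans (by simp)
    calc (n : ℝ) ≤ c + n := by linarith
      _ = ((x + (c + n : ℝ) * Complex.I : ℂ)).im := by simp
      _ ≤ _ := Complex.im_le_norm _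
  have hright : Tendsto (fun n : ℕ ↦ ∫ y in c..(c + n : ℝ), g (n + y * Complex.I))
      atTop (𝓝 0) := by
    refine squeeze_zero_norm' ?_ hzero
    filter_upwards [eventually_gt_atTop 0] with n hn
    refine (intervalIntegral.norm_integral_le_of_norm_le_const fun y hy ↦
      hgb n hn _ ?_ ?_).trans (by simp)
    · rw [Set.uIoc_of_le (by simp)] at hy
      simpa using hy.1.le
    · calc (n : ℝ) = ((n + y * Complex.I : ℂ)).re := by simp
        _ ≤ _ := Complex.re_le_norm _
  have hleft : Tendsto (fun n : ℕ ↦ ∫ y in c..(c + n : ℝ), g (Complex.I * y)) atTop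
      (𝓝 (∫ y in Set.Ioi c, g (Complex.I * y))) :=
    intervalIntegral_tendsto_integral_Ioi c hint
      (tendsto_atTop_add_const_left _ _ tendsto_natCast_atTop_atTop)
  have := (htop.sub (hright.const_mul Complex.I)).add (hleft.const_mul Complex.I)
  simp only [mul_zero, sub_zero, zero_add] at this
  exact this.congr fun n ↦ (hrect n).symm

/-- Unfolding the integral of a `1`-periodic function against the Hurwitz series. -/
theorem tendsto_integral_mul_tsum_cpow {ψ : ℂ → ℂ} {w : ℂ} (hw : 0 < w.im)
    (hψ : Continuous fun x : ℝ ↦ ψ (w + x)) (hper : Function.Periodic ψ 1) {s : ℂ}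
    (hs : 1 < s.re) :
    Tendsto (fun n : ℕ ↦ ∫ x in (0 : ℝ)..n, ψ (w + x) * (w + x) ^ (-s)) atTop
      (𝓝 (∫ x in (0 : ℝ)..1, ψ (w + x) * ∑' n : ℕ, (w + x + n) ^ (-s))) := by
  obtain ⟨C, hC0, hC⟩ := exists_norm_cpow_neg_le hw (zero_le_one.trans hs.le) ‖s‖ 1
  have hcont : Continuous fun x : ℝ ↦ ψ (w + x) * (w + x) ^ (-s) :=
    hψ.mul (Continuous.cpow (by fun_prop) continuous_const fun x ↦ by
      simpa using add_ofReal_add_natCast_mem_slitPlane hw x 0)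
  have hcontn : ∀ n : ℕ, Continuous fun x : ℝ ↦ ψ (w + x) * (w + x + n) ^ (-s) := fun n ↦
    hψ.mul (Continuous.cpow (by fun_prop) continuous_const fun x ↦
      add_ofReal_add_natCast_mem_slitPlane hw x n)
  have hsum : HasSum (fun n : ℕ ↦ ∫ x in (0 : ℝ)..1, ψ (w + x) * (w + x + n) ^ (-s))
      (∫ x in (0 : ℝ)..1, ψ (w + x) * ∑' n : ℕ, (w + x + n) ^ (-s)) := by
    refine intervalIntegral.hasSum_integral_of_dominated_convergence
      (fun n x ↦ ‖ψ (w + x)‖ * (C * (n + 1 : ℝ) ^ (-s.re))) (fun n ↦ ?_) (fun n ↦ ?_) ?_ ?_ ?_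
    · exact (hcontn n).aestronglyMeasurable
    · refine Eventually.of_forall fun x hx ↦ ?_
      rw [Set.uIoc_of_le zero_le_one] at hx
      rw [norm_mul]
      gcongr
      exact hC s le_rfl le_rfl x (abs_le.mpr ⟨by linarith [hx.1], hx.2⟩) n
    · exact Eventually.of_forall fun x _ ↦
        ((summable_natCast_add_one_rpow hs).mul_left C).mul_left _
    · simp_rw [tsum_mul_left]
      exact (hψ.norm.mul continuous_const).intervalIntegrable _ _
    · exact Eventually.of_forall fun x _ ↦ (summable_cpow_neg hw hs x).hasSum.mul_left _
  refine hsum.tendsto_sum_nat.congr fun n ↦ ?_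
  have hshift : ∀ j : ℕ, ∫ x in (0 : ℝ)..1, ψ (w + x) * (w + x + j) ^ (-s) =
      ∫ x in (j : ℝ)..(j + 1 : ℕ), ψ (w + x) * (w + x) ^ (-s) := by
    intro j
    have := intervalIntegral.integral_comp_add_right
      (fun x : ℝ ↦ ψ (w + x) * (w + x) ^ (-s)) (j : ℝ) (a := 0) (b := 1)
    rw [zero_add, add_comm (1 : ℝ), ← Nat.cast_add_one] at this
    rw [← this]
    refine intervalIntegral.integral_congr fun x _ ↦ ?_
    have hp := hper.nat_mul j (w + x)
    rw [mul_one] at hp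
    simp only [Complex.ofReal_add, Complex.ofReal_natCast]
    rw [← add_assoc, hp]
  simp_rw [hshift]
  rw [intervalIntegral.sum_integral_adjacent_intervals (a := fun j : ℕ ↦ (j : ℝ))
    fun j _ ↦ hcont.intervalIntegrable _ _]
  simp

theorem I_mul_ofReal_cpow {y : ℝ} (hy : 0 < y) (s : ℂ) :
    (Complex.I * y) ^ s = Complex.I ^ s * (y : ℂ) ^ s := by
  have hy' : (y : ℂ) ≠ 0 := Complex.ofReal_ne_zero.mpr hy.ne'
  rw [Complex.cpow_def_of_ne_zero (mul_ne_zero Complex.I_ne_zero hy'),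
    Complex.cpow_def_of_ne_zero Complex.I_ne_zero, Complex.cpow_def_of_ne_zero hy',
    Complex.log_mul_ofReal y hy _ Complex.I_ne_zero, ← Complex.exp_add, Complex.ofReal_log hy.le]
  ring_nf

/-- The part of the Mellin transform of `t ↦ ψ(it)` coming from `t > c`. -/
noncomputable def partialMellin (ψ : ℂ → ℂ) (c : ℝ) (s : ℂ) : ℂ :=
  mellin ((Set.Ioi c).indicator fun t : ℝ ↦ ψ (Complex.I * t)) s

theorem mellin_indicator_Ioi (F : ℝ → ℂ) {c : ℝ} (hc : 0 ≤ c) (s : ℂ) :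
    mellin ((Set.Ioi c).indicator F) s = ∫ t in Set.Ioi c, (t : ℂ) ^ (s - 1) * F t := by
  have h : (fun t : ℝ ↦ (t : ℂ) ^ (s - 1) • (Set.Ioi c).indicator F t) =
      (Set.Ioi c).indicator fun t : ℝ ↦ (t : ℂ) ^ (s - 1) * F t := by
    ext t
    by_cases ht : t ∈ Set.Ioi c <;> simp [ht]
  rw [mellin, h, setIntegral_indicator measurableSet_Ioi,
    Set.inter_eq_self_of_subset_right (Set.Ioi_subset_Ioi hc)]

theorem MellinConvergent.indicator {F : ℝ → ℂ} {s : ℂ} (h : MellinConvergent F s) {S : Set ℝ}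
    (hS : MeasurableSet S) : MellinConvergent (S.indicator F) s := by
  have e : (fun t : ℝ ↦ (t : ℂ) ^ (s - 1) • S.indicator F t) =
      S.indicator fun t : ℝ ↦ (t : ℂ) ^ (s - 1) • F t := by
    ext t
    by_cases ht : t ∈ S <;> simp [ht]
  rw [MellinConvergent, e]
  exact IntegrableOn.indicator h hS

theorem integral_mul_tsum_cpow_eq {ψ : ℂ → ℂ} (hψ : DifferentiableOn ℂ ψ {z | 0 < z.im})
    (hper : Function.Periodic ψ 1) {c : ℝ} (hc : 0 < c) {M : ℝ}
    (hM : ∀ z : ℂ, c ≤ z.im → ‖ψ z‖ ≤ M)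
    (hconv : ∀ s, MellinConvergent (fun t : ℝ ↦ ψ (Complex.I * t)) s) {s : ℂ} (hs : 1 < s.re) :
    ∫ x in (0 : ℝ)..1, ψ (Complex.I * c + x) * ∑' n : ℕ, (Complex.I * c + x + n) ^ (-s) =
      Complex.I * (Complex.I ^ (-s) * partialMellin ψ c (1 - s)) := by
  have hw : 0 < (Complex.I * c).im := by simpa using hc
  have hψc : Continuous fun x : ℝ ↦ ψ (Complex.I * c + x) :=
    hψ.continuousOn.comp_continuous (by fun_prop) fun x ↦ by simpa using hc
  have heq : Set.EqOn (fun y : ℝ ↦ Complex.I ^ (-s) *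
      ((y : ℂ) ^ ((1 - s) - 1) * ψ (Complex.I * y)))
      (fun y : ℝ ↦ ψ (Complex.I * y) * (Complex.I * y) ^ (-s)) (Set.Ioi c) := by
    intro y hy
    simp only
    rw [I_mul_ofReal_cpow (hc.trans hy), show (1 - s) - 1 = -s by ring]
    ring
  have hint : IntegrableOn (fun y : ℝ ↦ ψ (Complex.I * y) * (Complex.I * y) ^ (-s)) (Set.Ioi c) := by
    refine IntegrableOn.congr_fun ?_ heq measurableSet_Ioi
    exact ((hconv (1 - s)).mono_set (Set.Ioi_subset_Ioi hc.le)).const_mul _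
  rw [tendsto_nhds_unique (tendsto_integral_mul_tsum_cpow hw hψc hper hs)
    (tendsto_integral_horizontal hψ hc hM hs hint), partialMellin, mellin_indicator_Ioi _ hc.le,
    ← setIntegral_congr_fun measurableSet_Ioi heq, integral_const_mul]

theorem differentiable_partialMellin {ψ : ℂ → ℂ} (hψ : DifferentiableOn ℂ ψ {z | 0 < z.im})
    {c : ℝ} (hc : 0 < c)
    (hO : ∀ r : ℝ, (fun t : ℝ ↦ ψ (Complex.I * t)) =O[atTop] fun t : ℝ ↦ t ^ r) :
    Differentiable ℂ (partialMellin ψ c) := by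
  intro s
  refine mellin_differentiableAt_of_isBigO_rpow (a := s.re + 1) (b := s.re - 1) ?_ ?_
    (by linarith) ?_ (by linarith)
  · have hcont : ContinuousOn (fun t : ℝ ↦ ψ (Complex.I * t)) (Set.Ioi 0) :=
      hψ.continuousOn.comp (by fun_prop) fun t ht ↦ by simpa using ht
    intro t ht
    obtain ⟨u, hu, hi⟩ := hcont.locallyIntegrableOn (μ := volume) measurableSet_Ioi t ht
    exact ⟨u, hu, hi.indicator measurableSet_Ioi⟩
  · refine (hO _).congr' ?_ EventuallyEq.rfl
    filter_upwards [eventually_gt_atTop c] with t ht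
    simp [ht]
  -- The truncated function vanishes near `0`, so any exponent is admissible there.
  · refine (Asymptotics.isBigO_zero (fun t : ℝ ↦ t ^ (-(s.re - 1))) _).congr' ?_ EventuallyEq.rfl
    filter_upwards [mem_nhdsWithin_of_mem_nhds (Iio_mem_nhds hc)] with t ht
    exact (Set.indicator_of_notMem (by simpa using (Set.mem_Iio.mp ht).le) _).symm

/-- The integral of `ψ` against `ζ(s, ·)` along a period is, for all `s ≠ 1`, a Mellin integral
along the imaginary axis. -/
theorem integral_mul_hurwitzZetaComplex {ψ : ℂ → ℂ} (hψ : DifferentiableOn ℂ ψ {z | 0 < z.im})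
    (hper : Function.Periodic ψ 1) {c : ℝ} (hc : 0 < c) {M : ℝ}
    (hM : ∀ z : ℂ, c ≤ z.im → ‖ψ z‖ ≤ M)
    (hconv : ∀ s, MellinConvergent (fun t : ℝ ↦ ψ (Complex.I * t)) s)
    (hO : ∀ r : ℝ, (fun t : ℝ ↦ ψ (Complex.I * t)) =O[atTop] fun t : ℝ ↦ t ^ r)
    {s : ℂ} (hs : s ≠ 1) :
    ∫ x in (0 : ℝ)..1, ψ (Complex.I * c + x) * hurwitzZetaComplex s (Complex.I * c + x) =
      Complex.I * (Complex.I ^ (-s) * partialMellin ψ c (1 - s)) := by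
  have hw : 0 < (Complex.I * c).im := by simpa using hc
  have hψc : Continuous fun x : ℝ ↦ ψ (Complex.I * c + x) :=
    hψ.continuousOn.comp_continuous (by fun_prop) fun x ↦ by simpa using hc
  have hU : IsPreconnected ({1}ᶜ : Set ℂ) :=
    (isConnected_compl_singleton_of_one_lt_rank (by simp) 1).isPreconnected
  have hd := ((HolomorphicFamily.of_continuous hψc).mul
    (holomorphicFamily_hurwitzZetaComplex hw)).differentiableOn_integral isOpen_compl_singleton 0 1
  have hP := differentiable_partialMellin hψ hc hO
  have hR : Differentiable ℂ fun s ↦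
      Complex.I * (Complex.I ^ (-s) * partialMellin ψ c (1 - s)) := by
    refine (Differentiable.mul ?_ (hP.comp (by fun_prop))).const_mul _
    exact differentiable_neg.const_cpow (.inl Complex.I_ne_zero)
  refine (hd.analyticOnNhd isOpen_compl_singleton).eqOn_of_preconnected_of_eventuallyEq
    (hR.differentiableOn.analyticOnNhd isOpen_compl_singleton) hU (z₀ := 2) (by simp) ?_ hs
  have hV : {s : ℂ | 1 < s.re} ∈ 𝓝 (2 : ℂ) :=
    (isOpen_lt continuous_const Complex.continuous_re).mem_nhds (by simp)
  filter_upwards [hV] with s hs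
  rw [← integral_mul_tsum_cpow_eq hψ hper hc hM hconv hs]
  refine intervalIntegral.integral_congr fun x _ ↦ ?_
  rw [((isHurwitzContinuation_hurwitzZetaComplex hw x).2 s hs).tsum_eq]

end ContourShift

/-! ### Cusp forms: growth, Fricke symmetry and the Hurwitz integrals. -/

section CuspForms

open Filter Topology MeasureTheory

variable {N k : ℕ}

theorem cuspForm_differentiableOn (f : CuspFormGamma0 N k) :
    DifferentiableOn ℂ (fun z ↦ f (UpperHalfPlane.ofComplex z)) {z | 0 < z.im} :=
  UpperHalfPlane.mdifferentiable_iff.mp f.holo'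

theorem cuspForm_periodic (f : CuspFormGamma0 N k) :
    Function.Periodic (fun z ↦ f (UpperHalfPlane.ofComplex z)) 1 := by
  have h := SlashInvariantFormClass.periodic_comp_ofComplex (h := 1) f (by simp)
  rwa [Complex.ofReal_one] at h

theorem hurwitzIntegrand_eq_iteratedDeriv (f : CuspFormGamma0 N k) (r : ℕ) (x : ℝ) :
    hurwitzIntegrand f r x = iteratedDeriv r (fun s ↦
      f (UpperHalfPlane.ofComplex (Complex.I / √(N : ℝ) + x)) *
        hurwitzZetaComplex s (Complex.I / √(N : ℝ) + x)) (1 - (k : ℂ) / 2) := by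
  rw [iteratedDeriv_const_mul_field]
  rfl

theorem one_sub_natCast_div_two_ne_one (hk : 0 < k) : 1 - (k : ℂ) / 2 ≠ 1 := by
  simpa using hk.ne'

variable [NeZero N]

/-- The function `|f(z)| (Im z)^(k/2)` is bounded on the upper half-plane. -/
theorem cuspForm_bounded (f : CuspFormGamma0 N k) {c : ℝ} (hc : 0 < c) :
    ∃ M, ∀ z : ℂ, c ≤ z.im → ‖f (UpperHalfPlane.ofComplex z)‖ ≤ M := by
  obtain ⟨C, hC⟩ := CuspFormClass.exists_bound f
  refine ⟨|C| / c ^ (((k : ℤ) : ℝ) / 2), fun z hz ↦ (hC _).trans ?_⟩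
  have him : (UpperHalfPlane.ofComplex z).im = z.im := by
    rw [UpperHalfPlane.ofComplex_apply_of_im_pos (hc.trans_le hz)]
    rfl
  rw [him]
  gcongr
  exact le_abs_self C

theorem cuspForm_mellinConvergent (hk : 0 < k) (f : CuspFormGamma0 N k) (s : ℂ) :
    MellinConvergent (fun t : ℝ ↦ f (UpperHalfPlane.ofComplex (Complex.I * t))) s :=
  ((CuspForm.isStrongFEPair (Int.natCast_pos.mpr hk) f).hasMellin s).1

theorem cuspForm_isBigO (hk : 0 < k) (f : CuspFormGamma0 N k) (r : ℝ) :
    (fun t : ℝ ↦ f (UpperHalfPlane.ofComplex (Complex.I * t))) =O[atTop] fun t : ℝ ↦ t ^ r :=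
  (CuspForm.isStrongFEPair (Int.natCast_pos.mpr hk) f).hf_top r

/-- `W_N` maps `it` to `i/(Nt)`, with automorphy factor `√N · it`. -/
theorem IsFrickeInvariant.apply_I_mul {f : CuspFormGamma0 N k} (hf : IsFrickeInvariant f)
    {t : ℝ} (ht : 0 < t) :
    f (UpperHalfPlane.ofComplex (Complex.I * ((N * t)⁻¹ : ℝ))) =
      Complex.I ^ k * (√(N : ℝ) * t : ℂ) ^ k * f (UpperHalfPlane.ofComplex (Complex.I * t)) := by
  have hN : (0 : ℝ) < N := Nat.cast_pos.mpr (Nat.pos_of_ne_zero (NeZero.ne N))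
  have hsq : (√(N : ℝ) : ℂ) * √(N : ℝ) = N := by
    rw [← Complex.ofReal_mul, Real.mul_self_sqrt hN.le, Complex.ofReal_natCast]
  have hs0 : (√(N : ℝ) : ℂ) ≠ 0 := Complex.ofReal_ne_zero.mpr (Real.sqrt_pos.mpr hN).ne'
  have ht0 : (t : ℂ) ≠ 0 := Complex.ofReal_ne_zero.mpr ht.ne'
  have hpos : 0 < (Complex.I * t).im := by simpa using ht
  set τ := UpperHalfPlane.ofComplex (Complex.I * t) with hτ
  have hτc : (τ : ℂ) = Complex.I * t := by
    rw [hτ, UpperHalfPlane.ofComplex_apply_of_im_pos hpos]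
  have hact : (frickeMatrix N • τ) = UpperHalfPlane.ofComplex (Complex.I * ((N * t)⁻¹ : ℝ)) := by
    have hpos' : 0 < (Complex.I * ((N * t)⁻¹ : ℝ)).im := by
      rw [Complex.I_mul_im, Complex.ofReal_re]
      positivity
    rw [UpperHalfPlane.ofComplex_apply_of_im_pos hpos']
    ext
    rw [UpperHalfPlane.coe_specialLinearGroup_apply, hτc]
    simp only [frickeMatrix, Algebra.algebraMap_self, RingHom.id_apply, Matrix.of_apply,
      Matrix.cons_val', Matrix.cons_val_zero, Matrix.cons_val_one, Matrix.cons_val_fin_one,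
      Complex.ofReal_zero, zero_mul, zero_add, add_zero]
    push_cast
    rw [← hsq]
    field_simp
    rw [Complex.I_sq]
  have h := congrFun hf τ
  have hden : UpperHalfPlane.denom (frickeMatrix N : GL (Fin 2) ℝ) τ = √(N : ℝ) * (Complex.I * t) := by
    have h10 : (frickeMatrix N : GL (Fin 2) ℝ) 1 0 = √(N : ℝ) := rfl
    have h11 : (frickeMatrix N : GL (Fin 2) ℝ) 1 1 = 0 := rfl
    rw [UpperHalfPlane.denom, h10, h11, hτc, Complex.ofReal_zero, add_zero]
  have hdet : Matrix.GeneralLinearGroup.det (frickeMatrix N : GL (Fin 2) ℝ) = 1 :=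
    Units.ext (frickeMatrix N).2
  have hsmul : (frickeMatrix N : GL (Fin 2) ℝ) • τ = frickeMatrix N • τ := rfl
  rw [ModularForm.slash_apply, hden, hsmul, hact] at h
  simp only [UpperHalfPlane.σ, hdet, Units.val_one, zero_lt_one,
    if_true, ContinuousAlgEquiv.refl_apply, abs_one, Complex.ofReal_one, one_zpow, mul_one,
    zpow_neg, zpow_natCast] at h
  rw [← div_eq_mul_inv, div_eq_iff
    (pow_ne_zero k (mul_ne_zero hs0 (mul_ne_zero Complex.I_ne_zero ht0)))] at h
  rw [h]
  ring

/-- The Mellin integral is cut at `t = 1/√N`, the fixed point of `t ↦ 1/(Nt)`; this substitution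
carries the lower part to the upper one. -/
theorem cuspForm_Λ_eq (hk : 0 < k) {f : CuspFormGamma0 N k} (hf : IsFrickeInvariant f) (s : ℂ) :
    ModularForm.Λ (Int.natCast_pos.mpr hk) f s =
      partialMellin (fun z ↦ f (UpperHalfPlane.ofComplex z)) (√(N : ℝ))⁻¹ s +
        Complex.I ^ k * (√(N : ℝ) : ℂ) ^ k * (N : ℂ) ^ (-s) *
          partialMellin (fun z ↦ f (UpperHalfPlane.ofComplex z)) (√(N : ℝ))⁻¹ (k - s) := by
  have hN : (0 : ℝ) < N := Nat.cast_pos.mpr (Nat.pos_of_ne_zero (NeZero.ne N))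
  have hr : 0 < √(N : ℝ) := Real.sqrt_pos.mpr hN
  have hrr : √(N : ℝ) * √(N : ℝ) = N := Real.mul_self_sqrt hN.le
  have hr0 : (√(N : ℝ) : ℂ) ≠ 0 := Complex.ofReal_ne_zero.mpr hr.ne'
  have hN0 : (N : ℂ) ≠ 0 := NeZero.ne _
  have hrrC : (√(N : ℝ) : ℂ) * √(N : ℝ) = N := by
    rw [← Complex.ofReal_mul, hrr, Complex.ofReal_natCast]
  set c : ℝ := (√(N : ℝ))⁻¹ with hc
  have hc0 : 0 < c := inv_pos.mpr hr
  set F : ℝ → ℂ := fun t ↦ f (UpperHalfPlane.ofComplex (Complex.I * t)) with hF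
  have hconv := cuspForm_mellinConvergent hk f
  set Fc : ℝ → ℂ := (Set.Ioi c).indicator F with hFc
  have hlow : ∀ t ∈ Set.Ioi (0 : ℝ), (Set.Iio c).indicator F t =
      (Complex.I ^ k * ((√(N : ℝ) : ℂ) ^ k)⁻¹) * ((t : ℂ) ^ (-(k : ℂ)) • Fc ((N * t)⁻¹)) := by
    intro t (ht : 0 < t)
    have ht0 : (t : ℂ) ≠ 0 := Complex.ofReal_ne_zero.mpr ht.ne'
    have hiff : c < (N * t)⁻¹ ↔ t < c := by
      have e : (N : ℝ) * t = √(N : ℝ) * (t * √(N : ℝ)) := by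
        nth_rewrite 1 [← hrr]
        ring
      rw [hc, inv_lt_inv₀ hr (by positivity), e, mul_lt_iff_lt_one_right hr, ← one_div,
        lt_div_iff₀ hr]
    by_cases htc : t < c
    · have h := hf.apply_I_mul (t := (N * t)⁻¹) (by positivity)
      have e : (N * (N * t)⁻¹)⁻¹ = t := by field_simp
      rw [e] at h
      rw [Set.indicator_of_mem (show t ∈ Set.Iio c from htc), hFc, Set.indicator_of_mem (show _ ∈ Set.Ioi c from hiff.mpr htc), hF]
      simp only
      rw [h, Complex.cpow_neg, Complex.cpow_natCast, smul_eq_mul]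
      have e2 : (√(N : ℝ) : ℂ) * (((N * t)⁻¹ : ℝ) : ℂ) = (√(N : ℝ) : ℂ)⁻¹ * (t : ℂ)⁻¹ := by
        push_cast
        rw [← hrrC]
        field_simp
      rw [e2, mul_pow, inv_pow, inv_pow]
      ring
    · rw [Set.indicator_of_notMem (show t ∉ Set.Iio c from htc), hFc, Set.indicator_of_notMem (show _ ∉ Set.Ioi c from mt hiff.mp htc), smul_zero,
        mul_zero]
  have hlowM : mellin ((Set.Iio c).indicator F) s =
      Complex.I ^ k * (√(N : ℝ) : ℂ) ^ k * (N : ℂ) ^ (-s) * mellin Fc (k - s) := by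
    have h1 : mellin ((Set.Iio c).indicator F) s =
        mellin (fun t ↦ (Complex.I ^ k * ((√(N : ℝ) : ℂ) ^ k)⁻¹) •
          ((t : ℂ) ^ (-(k : ℂ)) • Fc ((N * t)⁻¹))) s :=
      setIntegral_congr_fun measurableSet_Ioi fun t ht ↦ by
        simp only
        rw [hlow t ht, smul_eq_mul (Complex.I ^ k * _)]
    rw [h1, mellin_const_smul, mellin_cpow_smul,
      mellin_comp_mul_left (fun t ↦ Fc t⁻¹) _ hN, mellin_comp_inv, smul_eq_mul, smul_eq_mul]
    have e1 : -(s + -(k : ℂ)) = k - s := by ring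
    have e2 : ((N : ℝ) : ℂ) ^ ((k : ℂ) - s) = (N : ℂ) ^ k * (N : ℂ) ^ (-s) := by
      rw [Complex.ofReal_natCast, sub_eq_add_neg, Complex.cpow_add _ _ hN0, Complex.cpow_natCast]
    rw [e1, e2]
    nth_rewrite 1 [← hrrC]
    rw [mul_pow]
    field_simp
  have hsplit : mellin F s = mellin Fc s + mellin ((Set.Iio c).indicator F) s := by
    have h1 := (hconv s).indicator (S := Set.Ioi c) measurableSet_Ioi
    have h2 := (hconv s).indicator (S := Set.Iio c) measurableSet_Iio
    rw [mellin, mellin, mellin, ← integral_add h1 h2]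
    refine integral_congr_ae (ae_restrict_of_ae ?_)
    -- Both indicators omit the cut point `c`, a null set.
    filter_upwards [compl_mem_ae_iff.mpr (measure_singleton (μ := volume) c)] with t ht
    rw [← smul_add]
    congr 1
    rcases lt_or_gt_of_ne (show t ≠ c from ht) with h | h
    · simp [hF, h, h.le]
    · simp [hF, h, h.le]
  rw [CuspForm.Λ_eq_mellin]
  change mellin F s = mellin Fc s + _ * mellin Fc _
  rw [hsplit, hlowM]

theorem holomorphicFamily_hurwitz_mul_cuspForm (f : CuspFormGamma0 N k) :
    HolomorphicFamily {1}ᶜ fun s x ↦ f (UpperHalfPlane.ofComplex (Complex.I / √(N : ℝ) + x)) *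
      hurwitzZetaComplex s (Complex.I / √(N : ℝ) + x) := by
  have hN : (0 : ℝ) < N := Nat.cast_pos.mpr (Nat.pos_of_ne_zero (NeZero.ne N))
  have hw : 0 < (Complex.I / √(N : ℝ)).im := by
    rw [Complex.div_ofReal_im, Complex.I_im]
    positivity
  refine (HolomorphicFamily.of_continuous ?_).mul (holomorphicFamily_hurwitzZetaComplex hw)
  exact (cuspForm_differentiableOn f).continuousOn.comp_continuous (by fun_prop) fun x ↦ by
    simpa using hw

theorem continuous_hurwitzIntegrand (hk : 0 < k) (f : CuspFormGamma0 N k) (r : ℕ) :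
    Continuous (hurwitzIntegrand f r) := by
  have := ((holomorphicFamily_hurwitz_mul_cuspForm f).iteratedDeriv isOpen_compl_singleton
    r).continuous_right (one_sub_natCast_div_two_ne_one hk)
  exact this.congr fun x ↦ (hurwitzIntegrand_eq_iteratedDeriv f r x).symm

theorem integral_hurwitzIntegrand (hk : 0 < k) (f : CuspFormGamma0 N k) (r : ℕ) :
    ∫ x in (0 : ℝ)..1, hurwitzIntegrand f r x = iteratedDeriv r (fun s ↦ Complex.I *
      (Complex.I ^ (-s) * partialMellin (fun z ↦ f (UpperHalfPlane.ofComplex z))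
        (√(N : ℝ))⁻¹ (1 - s))) (1 - (k : ℂ) / 2) := by
  have hN : (0 : ℝ) < N := Nat.cast_pos.mpr (Nat.pos_of_ne_zero (NeZero.ne N))
  have hc : 0 < (√(N : ℝ))⁻¹ := inv_pos.mpr (Real.sqrt_pos.mpr hN)
  have hs := one_sub_natCast_div_two_ne_one hk
  obtain ⟨M, hM⟩ := cuspForm_bounded f hc
  simp_rw [hurwitzIntegrand_eq_iteratedDeriv]
  rw [← (holomorphicFamily_hurwitz_mul_cuspForm f).iteratedDeriv_integral isOpen_compl_singleton
    0 1 r hs]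
  refine Filter.EventuallyEq.iteratedDeriv_eq r ?_
  filter_upwards [isOpen_compl_singleton.mem_nhds hs] with s hs
  rw [← integral_mul_hurwitzZetaComplex (cuspForm_differentiableOn f) (cuspForm_periodic f) hc hM
    (cuspForm_mellinConvergent hk f) (cuspForm_isBigO hk f) hs, Complex.ofReal_inv, div_eq_mul_inv]

end CuspForms

/-! ### Derivatives at the critical point. -/

section CriticalDerivative

open Filter Topology

variable {N k : ℕ} [NeZero N]

/-- The one-sided completed Mellin integral `∫_{1/√N}^∞ f(it) (√N t)^{-u} t^{k/2-1} dt`, centred at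
the critical point. -/
noncomputable def centeredMellin (f : CuspFormGamma0 N k) (u : ℂ) : ℂ :=
  Complex.exp (-(Real.log √(N : ℝ) : ℂ) * u) *
    partialMellin (fun z ↦ f (UpperHalfPlane.ofComplex z)) (√(N : ℝ))⁻¹ ((k : ℂ) / 2 - u)

theorem differentiable_partialMellin_cuspForm (hk : 0 < k) (f : CuspFormGamma0 N k) :
    Differentiable ℂ
      (partialMellin (fun z ↦ f (UpperHalfPlane.ofComplex z)) (√(N : ℝ))⁻¹) :=
  differentiable_partialMellin (cuspForm_differentiableOn f) (inv_pos.mpr (Real.sqrt_pos.mpr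
    (Nat.cast_pos.mpr (Nat.pos_of_ne_zero (NeZero.ne N))))) (cuspForm_isBigO hk f)

theorem differentiable_centeredMellin (hk : 0 < k) (f : CuspFormGamma0 N k) :
    Differentiable ℂ (centeredMellin f) :=
  Differentiable.mul (by fun_prop)
    ((differentiable_partialMellin_cuspForm hk f).comp (by fun_prop))

theorem log_I_div_sqrt :
    Complex.log (Complex.I / √(N : ℝ)) =
      -(Real.log √(N : ℝ) : ℂ) + Complex.log Complex.I := by
  have hr : 0 < √(N : ℝ) :=
    Real.sqrt_pos.mpr (Nat.cast_pos.mpr (Nat.pos_of_ne_zero (NeZero.ne N)))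
  rw [div_eq_mul_inv, ← Complex.ofReal_inv, Complex.log_mul_ofReal _ (inv_pos.mpr hr) _
    Complex.I_ne_zero, Real.log_inv, Complex.ofReal_neg]

/-- The Leibniz rule read backwards: `log(i/√N)^j` is the `j`-th derivative at `0` of `exp(u
log(i/√N))`. The `i^u` in this exponential cancels the `i^(-u)` of the unfolded integral. -/
theorem sum_log_pow_mul_integral_hurwitzIntegrand (hk : 0 < k) {κ : ℕ} (hκ : k = 2 * κ)
    (f : CuspFormGamma0 N k) (m : ℕ) :
    ∑ j ∈ Finset.range (m + 1), (m.choose j : ℂ) *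
      Complex.log (Complex.I / √(N : ℝ)) ^ j *
        ∫ x in (0 : ℝ)..1, hurwitzIntegrand f (m - j) x =
      Complex.I ^ κ * iteratedDeriv m (centeredMellin f) 0 := by
  set P := partialMellin (fun z ↦ f (UpperHalfPlane.ofComplex z)) (√(N : ℝ))⁻¹ with hPdef
  have hP : Differentiable ℂ P := differentiable_partialMellin_cuspForm hk f
  have hκ2 : (k : ℂ) / 2 = κ := by
    rw [hκ]
    push_cast
    ring
  set l := Complex.log (Complex.I / √(N : ℝ)) with hl
  set s₀ : ℂ := 1 - (k : ℂ) / 2 with hs₀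
  set H : ℂ → ℂ := fun s ↦ Complex.I * (Complex.I ^ (-s) * P (1 - s)) with hH
  have hHd : Differentiable ℂ H :=
    (Differentiable.mul (differentiable_neg.const_cpow (.inl Complex.I_ne_zero))
      (hP.comp (by fun_prop))).const_mul _
  have hHs : ∀ r, ∫ x in (0 : ℝ)..1, hurwitzIntegrand f r x =
      iteratedDeriv r (fun u ↦ H (s₀ + u)) 0 := fun r ↦ by
    rw [integral_hurwitzIntegrand hk, iteratedDeriv_comp_const_add]
    simp only [add_zero, hH, hPdef, hs₀]
  have hexp : ∀ j, iteratedDeriv j (fun u ↦ Complex.exp (l * u)) 0 = l ^ j := fun j ↦ by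
    rw [iteratedDeriv_cexp_const_mul]
    simp
  have hfun : (fun u ↦ Complex.exp (l * u) * H (s₀ + u)) =
      fun u ↦ Complex.I ^ κ * centeredMellin f u := by
    ext u
    have hI : Complex.exp (Complex.log Complex.I) = Complex.I := Complex.exp_log Complex.I_ne_zero
    have e1 : Complex.exp (l * u) * (Complex.I * Complex.I ^ (-(s₀ + u))) =
        Complex.I ^ κ * Complex.exp (-(Real.log √(N : ℝ) : ℂ) * u) := by
      rw [Complex.cpow_def_of_ne_zero Complex.I_ne_zero, hl, log_I_div_sqrt, hs₀, hκ2]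
      -- With the prefactor `i` and `i^κ` also written as exponentials, the claim becomes an
      -- identity of exponents.
      nth_rewrite 2 [← hI]
      nth_rewrite 4 [← hI]
      rw [← Complex.exp_nat_mul, ← Complex.exp_add, ← Complex.exp_add, ← Complex.exp_add]
      congr 1
      ring
    have e2 : 1 - (s₀ + u) = (k : ℂ) / 2 - u := by rw [hs₀]; ring
    rw [hH, centeredMellin]
    simp only
    rw [e2, ← mul_assoc Complex.I, ← mul_assoc, e1, mul_assoc]
  simp_rw [hHs, ← hexp]
  rw [← iteratedDeriv_const_mul_field, ← hfun, iteratedDeriv_fun_mul]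
  · exact (Differentiable.contDiff (by fun_prop)).contDiffAt
  · exact (Differentiable.contDiff (hHd.comp (by fun_prop))).contDiffAt

theorem exp_mul_Λ_eq (hk : 0 < k) {f : CuspFormGamma0 N k} (hf : IsFrickeInvariant f) (u : ℂ) :
    Complex.exp ((Real.log √(N : ℝ) : ℂ) * u) *
        ModularForm.Λ (Int.natCast_pos.mpr hk) f ((k : ℂ) / 2 + u) =
      centeredMellin f (-u) + Complex.I ^ k * centeredMellin f u := by
  have hN : (0 : ℝ) < N := Nat.cast_pos.mpr (Nat.pos_of_ne_zero (NeZero.ne N))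
  have hr : 0 < √(N : ℝ) := Real.sqrt_pos.mpr hN
  have hr0 : (√(N : ℝ) : ℂ) ≠ 0 := Complex.ofReal_ne_zero.mpr hr.ne'
  have hrrC : (√(N : ℝ) : ℂ) * √(N : ℝ) = N := by
    rw [← Complex.ofReal_mul, Real.mul_self_sqrt hN.le, Complex.ofReal_natCast]
  set l : ℂ := (Real.log √(N : ℝ) : ℂ) with hl
  have hNs : Complex.exp (l * u) *
      ((√(N : ℝ) : ℂ) ^ k * (N : ℂ) ^ (-((k : ℂ) / 2 + u))) = Complex.exp (-l * u) := by
    have hlr : Complex.log (√(N : ℝ) : ℂ) = l := (Complex.ofReal_log hr.le).symm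
    rw [← hrrC, Complex.mul_cpow_ofReal_nonneg hr.le hr.le, ← Complex.cpow_natCast,
      Complex.cpow_def_of_ne_zero hr0, Complex.cpow_def_of_ne_zero hr0, hlr,
      ← Complex.exp_add, ← Complex.exp_add, ← Complex.exp_add]
    congr 1
    ring
  rw [cuspForm_Λ_eq hk hf, centeredMellin, centeredMellin, ← hl,
    show (k : ℂ) - ((k : ℂ) / 2 + u) = (k : ℂ) / 2 - u by ring, ← hNs, sub_neg_eq_add,
    neg_mul_neg]
  ring

theorem iteratedDeriv_cuspFormL (hk : 0 < k) {κ : ℕ} (hκ : k = 2 * κ)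
    {f : CuspFormGamma0 N k} (hf : IsFrickeInvariant f) {m : ℕ}
    (hL : ∀ j < m, iteratedDeriv j (cuspFormL hk f) ((k : ℂ) / 2) = 0) :
    iteratedDeriv m (cuspFormL hk f) ((k : ℂ) / 2) =
      (2 * (π : ℂ)) ^ κ / ((κ - 1)! : ℕ) *
        ((Complex.I ^ k + (-1) ^ m) * iteratedDeriv m (centeredMellin f) 0) := by
  have hκ0 : 0 < κ := by omega
  have hκ2 : (k : ℂ) / 2 = κ := by
    rw [hκ]
    push_cast
    ring
  have hAd := differentiable_centeredMellin hk f
  have hLd := differentiable_cuspFormL hk f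
  set l : ℂ := (Real.log √(N : ℝ) : ℂ) with hl
  -- The factor with `E(u) L_f(k/2+u) = N^(u/2) Λ(k/2+u)`. The identity is used only near `u = 0`,
  -- where `Re(k/2+u) > 0` makes the Gamma factor holomorphic and nonzero.
  set E : ℂ → ℂ := fun u ↦ Complex.exp (l * u) *
    ((2 * (π : ℂ)) ^ (-((k : ℂ) / 2 + u)) * Complex.Gamma ((k : ℂ) / 2 + u)) with hE
  have h2π : (2 * (π : ℂ)) ≠ 0 := by simp [Real.pi_ne_zero]
  have hre : ∀ᶠ u : ℂ in 𝓝 0, 0 < ((k : ℂ) / 2 + u).re := by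
    have hopen : IsOpen {u : ℂ | 0 < ((k : ℂ) / 2 + u).re} :=
      isOpen_lt continuous_const (by fun_prop)
    refine hopen.mem_nhds ?_
    simp only [Set.mem_ofPred_eq, add_zero, hκ2, Complex.natCast_re]
    exact_mod_cast hκ0
  have hEd : ContDiffAt ℂ m E 0 := by
    refine (DifferentiableOn.analyticAt (s := {u : ℂ | 0 < ((k : ℂ) / 2 + u).re})
      ?_ hre).contDiffAt
    intro u hu
    have hΓ : DifferentiableAt ℂ (fun u ↦ Complex.Gamma ((k : ℂ) / 2 + u)) u := by
      refine DifferentiableAt.comp (g := Complex.Gamma) u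
        (Complex.differentiableAt_Gamma _ fun n hn ↦ ?_) (by fun_prop)
      have hu' : 0 < ((k : ℂ) / 2 + u).re := hu
      rw [hn, Complex.neg_re, Complex.natCast_re] at hu'
      have := n.cast_nonneg (α := ℝ)
      linarith
    refine DifferentiableAt.differentiableWithinAt ?_
    exact DifferentiableAt.mul (by fun_prop)
      (DifferentiableAt.mul (DifferentiableAt.const_cpow (by fun_prop) (.inl h2π)) hΓ)
  have hE0 : E 0 = ((2 * (π : ℂ)) ^ κ)⁻¹ * ((κ - 1)! : ℕ) := by
    have hΓ : Complex.Gamma κ = ((κ - 1)! : ℕ) := by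
      rw [← Complex.Gamma_nat_eq_factorial, ← Nat.cast_add_one, Nat.sub_add_cancel hκ0]
    simp [hE, hκ2, hΓ, Complex.cpow_neg]
  have hfun : (fun u ↦ E u * cuspFormL hk f ((k : ℂ) / 2 + u)) =ᶠ[𝓝 0]
      fun u ↦ centeredMellin f (-u) + Complex.I ^ k * centeredMellin f u := by
    filter_upwards [hre] with u hu
    have hΓ := Complex.Gamma_ne_zero_of_re_pos hu
    have hp : (2 * (π : ℂ)) ^ (-((k : ℂ) / 2 + u)) ≠ 0 :=
      Complex.cpow_ne_zero_iff.mpr (.inl h2π)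
    rw [← exp_mul_Λ_eq hk hf, cuspFormL, ModularForm.L, Complex.Gammaℂ_def, ← hl]
    simp only [hE]
    generalize (k : ℂ) / 2 + u = s at hΓ hp ⊢
    field_simp
  have hleft : iteratedDeriv m (fun u ↦ E u * cuspFormL hk f ((k : ℂ) / 2 + u)) 0 =
      E 0 * iteratedDeriv m (cuspFormL hk f) ((k : ℂ) / 2) := by
    have hLs : Differentiable ℂ fun u ↦ cuspFormL hk f ((k : ℂ) / 2 + u) :=
      hLd.comp (by fun_prop)
    -- Every Leibniz term with `j > 0` contains a derivative of `L_f` of order `m - j < m`, which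
    -- vanishes.
    rw [iteratedDeriv_fun_mul hEd hLs.contDiff.contDiffAt, Finset.sum_eq_single 0]
    · simp [iteratedDeriv_comp_const_add]
    · intro j hj hj0
      have : m - j < m := by
        have := Finset.mem_range.mp hj
        omega
      simp only [iteratedDeriv_comp_const_add, add_zero]
      rw [hL _ this, mul_zero]
    · simp
  have hright : iteratedDeriv m
      (fun u ↦ centeredMellin f (-u) + Complex.I ^ k * centeredMellin f u) 0 =
      (Complex.I ^ k + (-1) ^ m) * iteratedDeriv m (centeredMellin f) 0 := by
    have hAneg : Differentiable ℂ fun u ↦ centeredMellin f (-u) := hAd.comp differentiable_neg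
    rw [iteratedDeriv_fun_add hAneg.contDiff.contDiffAt
      (Differentiable.contDiff (hAd.const_mul _)).contDiffAt, iteratedDeriv_comp_neg,
      iteratedDeriv_const_mul_field, neg_zero, smul_eq_mul]
    ring
  rw [← hright, ← hfun.iteratedDeriv_eq, hleft, hE0]
  have : (((κ - 1)! : ℕ) : ℂ) ≠ 0 := Nat.cast_ne_zero.mpr (Nat.factorial_ne_zero _)
  field_simp

end CriticalDerivative

theorem mainTheorem2 (N k m : ℕ) [NeZero N] (hk : 0 < k) (hk2 : Even k) (hm : 0 < m)
    (f : CuspFormGamma0 N k) (hf : IsFrickeInvariant f)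
    (hL : ∀ j < m, iteratedDeriv j (cuspFormL hk f) ((k : ℂ) / 2) = 0) :
    (∀ r ≤ m, IntervalIntegrable (hurwitzIntegrand f r) MeasureTheory.volume 0 1) ∧
    iteratedDeriv m (cuspFormL hk f) ((k : ℂ) / 2) =
      (Complex.I ^ k + Complex.I ^ (2 * m)) / ((k / 2 - 1)! : ℕ) *
        (-2 * (π : ℂ) * Complex.I) ^ (k / 2) *
        ∑ j ∈ Finset.range (m + 1), (m.choose j : ℂ) *
          Complex.log (Complex.I / √(N : ℝ)) ^ j *
          ∫ x in (0 : ℝ)..1, hurwitzIntegrand f (m - j) x := by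
  refine ⟨fun r _ ↦ (continuous_hurwitzIntegrand hk f r).intervalIntegrable 0 1, ?_⟩
  obtain ⟨κ, hκ⟩ := hk2
  have hκ' : k = 2 * κ := by omega
  have hdiv : k / 2 = κ := by omega
  have hpow : (-2 * (π : ℂ) * Complex.I) ^ κ * Complex.I ^ κ = (2 * (π : ℂ)) ^ κ := by
    rw [← mul_pow, mul_assoc, Complex.I_mul_I]
    ring
  -- The constants match because `(-2πi)^κ i^κ = (2π)^κ` and `i^(2m) = (-1)^m`.
  rw [sum_log_pow_mul_integral_hurwitzIntegrand hk hκ', iteratedDeriv_cuspFormL hk hκ' hf hL, hdiv,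
    ← hpow, pow_mul Complex.I 2 m, Complex.I_sq]
  ring
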